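/- Let $U(1),U(2),\dots$ be independent random variables such that $U(n)$ is uniformly distributed on $\{1,\dots,n\}$ for each $n\ge 1$. Let the reverting clock $(T_n)_{n\ge1}$ be defined by $T_1=0$ and $T_{n+1}=1+T_{U(n)}$ for $n\ge 1$. Put $m_n=\mathrm{E}\,T_n$ and $v_n=\operatorname{Var} T_n$. Then, for every $n\ge1$, $T_n$ is square-integrable, $$m_n=\sum_{k=1}^{n-1}\frac1k,\qquad v_n=\sum_{k=1}^{n-1}\Bigl(\frac1k-\frac1{k^2}\Bigr),$$ and for each fixed real $x$, $$\Pr\left(\frac{T_n-m_n}{v_n^{1/2}}\le x\right)\to\Phi(x)\qquad\text{as } n\to\infty,$$ where $\Phi$ is the standard normal distribution function. (The quotient is defined for $n\ge3$, when $v_n>0$.) -/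

import Mathlib

open MeasureTheory ProbabilityTheory Filter Topology

/-! Conditioning on U(n) gives n E f(T_{n+1}) = ∑_{k ≤ n} E f(1 + T_k) for every f; differencing in
n yields the one-step recurrence `integral_clock_recurrence`. With f linear or quadratic it gives
the mean and variance. With f = exp(z ·) it gives E exp(z T_n) = ∏_{k<n} (1 + (e^z - 1)/k), so T_n
has the law of a sum of independent Bernoulli(1/k) variables, 1 ≤ k < n. The limit is then
Lyapunov's theorem on the level of characteristic functions: each centred factor is within O(|s|³
Var) of its Gaussian counterpart, so at s = t/√v_n the product is within O(|t|³/√v_n) of exp(-t²/2),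
and v_n → ∞ because the harmonic series diverges while ∑ 1/k² converges. Lévy's continuity theorem
concludes. -/

/-- The clock reading at time `n` when the value at time `k + 1` is one more than the value at
time `u k`. -/
def clock (u : ℕ → ℕ) : ℕ → ℕ
  | 0 => 0
  -- The default 0 makes the reading at time 1 equal to 0, the range being empty there, and keeps
  -- `clock u n ≤ n` for every `u`.
  | n + 1 => if h : 1 ≤ u n ∧ u n ≤ n then 1 + clock u (u n) else 0
decreasing_by omega

lemma clock_succ (u : ℕ → ℕ) (n : ℕ) :
    clock u (n + 1) = if 1 ≤ u n ∧ u n ≤ n then 1 + clock u (u n) else 0 := by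
  rw [clock]; split_ifs <;> rfl

lemma clock_one (u : ℕ → ℕ) : clock u 1 = 0 := by
  rw [clock_succ, if_neg (by omega)]

lemma clock_le (u : ℕ → ℕ) (n : ℕ) : clock u n ≤ n := by
  induction n using Nat.strong_induction_on with
  | _ n ih =>
    cases n with
    | zero => simp [clock]
    | succ n =>
      rw [clock_succ]
      split_ifs with h
      · have := ih (u n) (by omega)
        omega
      · omega

lemma clock_congr {u w : ℕ → ℕ} {n : ℕ} (h : ∀ i, 1 ≤ i → i < n → u i = w i) :
    clock u n = clock w n := by
  induction n using Nat.strong_induction_on with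
  | _ n ih =>
    cases n with
    | zero => simp [clock]
    | succ n =>
      rw [clock_succ, clock_succ]
      rcases Nat.eq_zero_or_pos n with rfl | hn
      · rw [if_neg (by omega), if_neg (by omega)]
      rw [← h n hn (by omega)]
      split_ifs with hu
      · rw [ih (u n) (by omega) fun i h1 h2 => h i h1 (by omega)]
      · rfl

/-- Source of both measurability and independence: the reading at time n + 1 involves only U(1), …,
U(n), and any function on the countable discrete space of their values is measurable. -/
lemma exists_clock_eq_comp {Ω : Type*} (U : ℕ → Ω → ℕ) (n : ℕ) :
    ∃ g : (Finset.range n → ℕ) → ℕ,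
      (fun ω => clock (fun i => U i ω) (n + 1)) = fun ω => g fun i => U (i + 1) ω := by
  refine ⟨fun a => clock (fun i => if h : i - 1 ∈ Finset.range n then a ⟨i - 1, h⟩ else 0) (n + 1),
    funext fun ω => clock_congr fun i h1 h2 => ?_⟩
  have : i - 1 ∈ Finset.range n := by simp; omega
  simp only [this, dif_pos, Nat.sub_add_cancel h1]

/-! ### Moments and generating function of the clock -/

section Law

variable {Ω : Type*} [MeasurableSpace Ω] {μ : Measure Ω} {U : ℕ → Ω → ℕ}

lemma aemeasurable_clock (hU : ∀ n, 1 ≤ n → AEMeasurable (U n) μ) (n : ℕ) :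
    AEMeasurable (fun ω => clock (fun i => U i ω) n) μ := by
  cases n with
  | zero => simp [clock]
  | succ n =>
    obtain ⟨g, hg⟩ := exists_clock_eq_comp U n
    rw [hg]
    exact (Measurable.of_discrete (f := g)).comp_aemeasurable
      (aemeasurable_pi_lambda _ fun i => hU _ (by omega))

lemma indepFun_clock [IsProbabilityMeasure μ] (hU : ∀ n, 1 ≤ n → AEMeasurable (U n) μ)
    (hind : iIndepFun (fun n : ℕ => U (n + 1)) μ) {k n : ℕ} (hk : k ≤ n + 1) :
    IndepFun (U (n + 1)) (fun ω => clock (fun i => U i ω) k) μ := by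
  cases k with
  | zero => simpa [clock] using indepFun_const_right (μ := μ) (U (n + 1)) 0
  | succ k =>
    obtain ⟨g, hg⟩ := exists_clock_eq_comp U k
    rw [hg]
    have h := hind.indepFun_finset₀ {n} (Finset.range k) (by simp; omega) fun i => hU _ (by omega)
    exact h.comp (φ := fun a => a ⟨n, by simp⟩) (ψ := g) .of_discrete .of_discrete

lemma integrable_comp_clock [IsProbabilityMeasure μ] {𝕜 : Type*} [RCLike 𝕜]
    (hU : ∀ n, 1 ≤ n → AEMeasurable (U n) μ)
    (f : ℕ → 𝕜) (n : ℕ) : Integrable (fun ω => f (clock (fun i => U i ω) n)) μ := by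
  refine Integrable.of_bound (C := ∑ k ∈ Finset.range (n + 1), ‖f k‖)
    ((Measurable.of_discrete (f := f)).comp_aemeasurable
      (aemeasurable_clock hU n)).aestronglyMeasurable (ae_of_all _ fun ω => ?_)
  exact Finset.single_le_sum (f := fun k => ‖f k‖) (fun _ _ => norm_nonneg _)
    (by simpa [Nat.lt_succ_iff] using clock_le _ n)

lemma ae_mem_Icc (hU : ∀ n, 1 ≤ n → HasLaw (U n) (uniformOn (Set.Icc 1 n)) μ)
    {n : ℕ} (hn : 1 ≤ n) : ∀ᵐ ω ∂μ, 1 ≤ U n ω ∧ U n ω ≤ n := by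
  have h : ∀ᵐ k ∂(uniformOn (Set.Icc 1 n) : Measure ℕ), k ∈ Set.Icc 1 n :=
    ae_cond_mem measurableSet_Icc
  rw [← (hU n hn).map_eq] at h
  exact ae_of_ae_map (hU n hn).aemeasurable h

lemma measureReal_eq_of_uniform (hU : ∀ n, 1 ≤ n → HasLaw (U n) (uniformOn (Set.Icc 1 n)) μ)
    {n k : ℕ} (hk : k ∈ Finset.Icc 1 n) : μ.real {ω | U n ω = k} = 1 / n := by
  have h1 := Finset.mem_Icc.1 hk
  have h := (hU n (by omega)).measure_eq (p := fun j => j = k) .of_discrete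
  rw [measureReal_def, h]
  have : (uniformOn (Set.Icc 1 n) : Measure ℕ) {x | x = k} =
      uniformOn ((Finset.Icc 1 n : Finset ℕ) : Set ℕ) (({k} : Finset ℕ) : Set ℕ) := by simp
  rw [this, uniformOn_apply_finset, Finset.inter_singleton_of_mem hk]
  simp

variable [IsProbabilityMeasure μ]

/-- Split according to the value k of U(n). For each fixed k ≤ n the reading at time k depends only
on U(1), …, U(k - 1), hence is independent of the event U(n) = k, which has probability 1/n. -/
lemma integral_clock_succ {𝕜 : Type*} [RCLike 𝕜]
    (hU : ∀ n, 1 ≤ n → HasLaw (U n) (uniformOn (Set.Icc 1 n)) μ)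
    (hind : iIndepFun (fun n : ℕ => U (n + 1)) μ) (f : ℕ → 𝕜) {n : ℕ} (hn : 1 ≤ n) :
    n * ∫ ω, f (clock (fun i => U i ω) (n + 1)) ∂μ =
      ∑ k ∈ Finset.Icc 1 n, ∫ ω, f (1 + clock (fun i => U i ω) k) ∂μ := by
  have hm : ∀ n, 1 ≤ n → AEMeasurable (U n) μ := fun n hn => (hU n hn).aemeasurable
  have hae : ∀ᵐ ω ∂μ, f (clock (fun i => U i ω) (n + 1)) =
      ∑ k ∈ Finset.Icc 1 n, (if U n ω = k then 1 else 0) * f (1 + clock (fun i => U i ω) k) := by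
    filter_upwards [ae_mem_Icc hU hn] with ω hω
    rw [clock_succ, if_pos hω]
    simp [hω]
  have hind' : ∀ k ∈ Finset.Icc 1 n,
      IndepFun (fun ω => if U n ω = k then (1 : 𝕜) else 0)
        (fun ω => f (1 + clock (fun i => U i ω) k)) μ := fun k hk => by
    obtain ⟨l, rfl⟩ := Nat.exists_eq_add_of_le' hn
    exact (indepFun_clock hm hind (Finset.mem_Icc.1 hk).2).comp
      (φ := fun j => if j = k then (1 : 𝕜) else 0) (ψ := fun j => f (1 + j))
      .of_discrete .of_discrete
  have hmI : ∀ k, AEStronglyMeasurable (fun ω => if U n ω = k then (1 : 𝕜) else 0) μ := fun k =>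
    ((Measurable.of_discrete (f := fun j => if j = k then (1 : 𝕜) else 0)).comp_aemeasurable
      (hm n hn)).aestronglyMeasurable
  have hint := fun k => integrable_comp_clock hm (fun j => f (1 + j)) k
  rw [integral_congr_ae hae, integral_finsetSum, Finset.mul_sum]
  · refine Finset.sum_congr rfl fun k hk => ?_
    rw [(hind' k hk).integral_fun_mul_eq_mul_integral (hmI k) (hint k).aestronglyMeasurable]
    have hP : ∫ ω, (if U n ω = k then (1 : 𝕜) else 0) ∂μ = 1 / n := by
      have hnull : NullMeasurableSet {ω | U n ω = k} μ :=
        (hm n hn).nullMeasurable (measurableSet_singleton k)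
      have h := integral_indicator₀ (f := fun _ => (1 : 𝕜)) hnull
      have h2 : (Set.indicator {ω | U n ω = k} fun _ => (1 : 𝕜)) =
          fun ω => if U n ω = k then (1 : 𝕜) else 0 := by
        ext ω; simp [Set.indicator]
      rw [h2] at h
      rw [h, setIntegral_const, measureReal_eq_of_uniform hU hk, RCLike.real_smul_eq_coe_mul]
      push_cast
      simp
    rw [hP, ← mul_assoc, mul_one_div_cancel (by exact_mod_cast (by omega : n ≠ 0)), one_mul]
  · intro k hk
    refine (hint k).bdd_mul (c := 1) (hmI k) (ae_of_all _ fun ω => ?_)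
    split_ifs <;> simp

/-- The sums for n + 1 and n differ only in their top term; for n = 0 the factor n removes the
missing identity. -/
lemma integral_clock_recurrence {𝕜 : Type*} [RCLike 𝕜]
    (hU : ∀ n, 1 ≤ n → HasLaw (U n) (uniformOn (Set.Icc 1 n)) μ)
    (hind : iIndepFun (fun n : ℕ => U (n + 1)) μ) (f : ℕ → 𝕜) (n : ℕ) :
    (n + 1) * ∫ ω, f (clock (fun i => U i ω) (n + 2)) ∂μ =
      n * ∫ ω, f (clock (fun i => U i ω) (n + 1)) ∂μ +
        ∫ ω, f (1 + clock (fun i => U i ω) (n + 1)) ∂μ := by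
  have h := integral_clock_succ hU hind f (n := n + 1) (by omega)
  rw [Finset.sum_Icc_succ_top (by omega)] at h
  push_cast at h
  rw [h]
  rcases Nat.eq_zero_or_pos n with rfl | hn
  · simp
  · rw [integral_clock_succ hU hind f hn]

lemma integral_clock (hU : ∀ n, 1 ≤ n → HasLaw (U n) (uniformOn (Set.Icc 1 n)) μ)
    (hind : iIndepFun (fun n : ℕ => U (n + 1)) μ) (n : ℕ) :
    ∫ ω, (clock (fun i => U i ω) (n + 1) : ℝ) ∂μ = ∑ k ∈ Finset.Ico 1 (n + 1), 1 / (k : ℝ) := by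
  induction n with
  | zero => simp [clock_one]
  | succ n ih =>
    have h := integral_clock_recurrence hU hind (fun j => (j : ℝ)) n
    have hint := integrable_comp_clock (fun n hn => (hU n hn).aemeasurable)
      (fun j => (j : ℝ)) (n + 1)
    push_cast at h
    rw [integral_add (integrable_const _) hint, integral_const, probReal_univ, one_smul] at h
    rw [Finset.sum_Ico_succ_top (by omega), ← ih]
    have : (n : ℝ) + 1 ≠ 0 := by positivity
    push_cast
    field_simp
    linear_combination h

lemma integral_clock_sq (hU : ∀ n, 1 ≤ n → HasLaw (U n) (uniformOn (Set.Icc 1 n)) μ)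
    (hind : iIndepFun (fun n : ℕ => U (n + 1)) μ) (n : ℕ) :
    ∫ ω, (clock (fun i => U i ω) (n + 1) : ℝ) ^ 2 ∂μ =
      ∑ k ∈ Finset.Ico 1 (n + 1), (1 / (k : ℝ) - 1 / (k : ℝ) ^ 2) +
        (∑ k ∈ Finset.Ico 1 (n + 1), 1 / (k : ℝ)) ^ 2 := by
  induction n with
  | zero => simp [clock_one]
  | succ n ih =>
    have h := integral_clock_recurrence hU hind (fun j => (j : ℝ) ^ 2) n
    have hm : ∀ n, 1 ≤ n → AEMeasurable (U n) μ := fun n hn => (hU n hn).aemeasurable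
    have hint := integrable_comp_clock hm (fun j => (j : ℝ)) (n + 1)
    have hint2 := integrable_comp_clock hm (fun j => (j : ℝ) ^ 2) (n + 1)
    have hexp : ∫ ω, ((1 + clock (fun i => U i ω) (n + 1) : ℕ) : ℝ) ^ 2 ∂μ =
        1 + 2 * ∫ ω, (clock (fun i => U i ω) (n + 1) : ℝ) ∂μ +
          ∫ ω, (clock (fun i => U i ω) (n + 1) : ℝ) ^ 2 ∂μ := by
      have : ∀ ω, ((1 + clock (fun i => U i ω) (n + 1) : ℕ) : ℝ) ^ 2 =
        1 + 2 * (clock (fun i => U i ω) (n + 1) : ℝ) +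
          (clock (fun i => U i ω) (n + 1) : ℝ) ^ 2 := fun ω => by push_cast; ring
      simp_rw [this]
      rw [integral_add (by fun_prop) hint2, integral_add (integrable_const _) (by fun_prop),
        integral_const_mul]
      simp
    rw [hexp, integral_clock hU hind, ih] at h
    simp only [Finset.sum_Ico_succ_top (show 1 ≤ n + 1 by omega)]
    have : (n : ℝ) + 1 ≠ 0 := by positivity
    refine mul_left_cancel₀ this (h.trans ?_)
    generalize ∑ k ∈ Finset.Ico 1 (n + 1), (1 / (k : ℝ) - 1 / (k : ℝ) ^ 2) = A
    generalize ∑ k ∈ Finset.Ico 1 (n + 1), 1 / (k : ℝ) = B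
    push_cast
    field_simp
    ring

lemma integral_exp_clock (hU : ∀ n, 1 ≤ n → HasLaw (U n) (uniformOn (Set.Icc 1 n)) μ)
    (hind : iIndepFun (fun n : ℕ => U (n + 1)) μ) (z : ℂ) (n : ℕ) :
    ∫ ω, Complex.exp (z * (clock (fun i => U i ω) (n + 1) : ℂ)) ∂μ =
      ∏ k ∈ Finset.Ico 1 (n + 1), (1 + (Complex.exp z - 1) / k) := by
  induction n with
  | zero => simp [clock_one]
  | succ n ih =>
    have h := integral_clock_recurrence hU hind (fun j => Complex.exp (z * j)) n
    push_cast at h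
    simp_rw [mul_add, mul_one, Complex.exp_add, integral_const_mul] at h
    rw [Finset.prod_Ico_succ_top (by omega), ← ih]
    have : (n : ℂ) + 1 ≠ 0 := by exact_mod_cast Nat.succ_ne_zero n
    push_cast
    field_simp
    linear_combination h

end Law

/-! ### Gaussian approximation of Bernoulli characteristic functions -/

lemma norm_prod_sub_prod_le_sum {ι : Type*} (s : Finset ι) (a b : ι → ℂ)
    (ha : ∀ i ∈ s, ‖a i‖ ≤ 1) (hb : ∀ i ∈ s, ‖b i‖ ≤ 1) :
    ‖∏ i ∈ s, a i - ∏ i ∈ s, b i‖ ≤ ∑ i ∈ s, ‖a i - b i‖ := by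
  classical
  induction s using Finset.induction_on with
  | empty => simp
  | insert i s hi ih =>
    simp only [Finset.forall_mem_insert] at ha hb
    have hA : ‖∏ j ∈ s, a j‖ ≤ 1 := by
      rw [norm_prod]; exact Finset.prod_le_one (fun _ _ => norm_nonneg _) ha.2
    rw [Finset.prod_insert hi, Finset.prod_insert hi, Finset.sum_insert hi]
    calc ‖a i * ∏ j ∈ s, a j - b i * ∏ j ∈ s, b j‖
        = ‖(a i - b i) * ∏ j ∈ s, a j + b i * (∏ j ∈ s, a j - ∏ j ∈ s, b j)‖ := by ring_nf
      _ ≤ ‖a i - b i‖ * 1 + 1 * ∑ j ∈ s, ‖a j - b j‖ := by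
        refine (norm_add_le _ _).trans ?_
        rw [norm_mul, norm_mul]
        gcongr
        · exact hb.1
        · exact ih ha.2 hb.2
      _ = _ := by ring

lemma norm_cexp_mul_I_sub_taylor_le {x : ℝ} (hx : |x| ≤ 1) :
    ‖Complex.exp (x * Complex.I) - (1 + x * Complex.I - x ^ 2 / 2)‖ ≤ |x| ^ 3 := by
  have hn : ‖(x : ℂ) * Complex.I‖ = |x| := by simp
  have h := Complex.exp_bound (x := x * Complex.I) (by rwa [hn]) (n := 3) (by norm_num)
  rw [hn] at h
  have e : ∑ m ∈ Finset.range 3, ((x : ℂ) * Complex.I) ^ m / m.factorial =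
      1 + x * Complex.I - x ^ 2 / 2 := by
    simp only [Finset.sum_range_succ, Finset.sum_range_zero, mul_pow, Complex.I_sq]
    simp [Nat.factorial]
    ring
  rw [e] at h
  refine h.trans (mul_le_of_le_one_right (by positivity) ?_)
  -- The constant in `Complex.exp_bound` is 4 / (3! · 3) < 1.
  norm_num [Nat.factorial]

/-- The characteristic function at `s` of a centred Bernoulli variable of parameter `p`. -/
noncomputable def bernoulliCharFun (p s : ℝ) : ℂ :=
  Complex.exp ((-(s * p) : ℝ) * Complex.I) * (1 + (Complex.exp (s * Complex.I) - 1) * p)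

/-- As a convex combination of unimodular numbers the value has norm at most 1, and its Taylor
expansion has no linear term. -/
lemma bernoulliCharFun_eq (p s : ℝ) : bernoulliCharFun p s =
    (1 - p) * Complex.exp ((-(s * p) : ℝ) * Complex.I) +
      p * Complex.exp ((s * (1 - p) : ℝ) * Complex.I) := by
  have : Complex.exp ((s * (1 - p) : ℝ) * Complex.I) =
      Complex.exp ((-(s * p) : ℝ) * Complex.I) * Complex.exp (s * Complex.I) := by
    rw [← Complex.exp_add]; push_cast; ring_nf
  rw [bernoulliCharFun, this]; ring

lemma norm_ofReal_mul_add_ofReal_mul_le {p : ℝ} (h0 : 0 ≤ p) (h1 : p ≤ 1) (z w : ℂ) :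
    ‖(1 - p) * z + p * w‖ ≤ (1 - p) * ‖z‖ + p * ‖w‖ := by
  have e : ((1 : ℂ) - p) = ((1 - p : ℝ) : ℂ) := by push_cast; rfl
  refine (norm_add_le _ _).trans (le_of_eq ?_)
  rw [e, norm_mul, norm_mul, Complex.norm_of_nonneg h0, Complex.norm_of_nonneg (by linarith)]

lemma norm_bernoulliCharFun_le_one {p : ℝ} (h0 : 0 ≤ p) (h1 : p ≤ 1) (s : ℝ) :
    ‖bernoulliCharFun p s‖ ≤ 1 := by
  rw [bernoulliCharFun_eq]
  refine (norm_ofReal_mul_add_ofReal_mul_le h0 h1 _ _).trans ?_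
  rw [Complex.norm_exp_ofReal_mul_I, Complex.norm_exp_ofReal_mul_I]
  linarith

/-- Both sides agree with 1 - s²(p - p²)/2 to second order. The bound is kept proportional to the
variance p - p², so that summing over factors produces the total variance. -/
lemma norm_bernoulliCharFun_sub_exp_le {p s : ℝ} (h0 : 0 ≤ p) (h1 : p ≤ 1) (hs : |s| ≤ 1) :
    ‖bernoulliCharFun p s - Complex.exp ((-(s ^ 2 / 2 * (p - p ^ 2)) : ℝ))‖ ≤
      2 * |s| ^ 3 * (p - p ^ 2) := by
  have hq : 0 ≤ 1 - p := by linarith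
  have hsn := abs_nonneg s
  have hv : 0 ≤ p - p ^ 2 := by nlinarith
  have hv1 : p - p ^ 2 ≤ 1 := by nlinarith
  have e1 : |-(s * p)| = |s| * p := by rw [abs_neg, abs_mul, abs_of_nonneg h0]
  have e2 : |s * (1 - p)| = |s| * (1 - p) := by rw [abs_mul, abs_of_nonneg hq]
  have t1 := norm_cexp_mul_I_sub_taylor_le (x := -(s * p)) (by rw [e1]; nlinarith)
  have t2 := norm_cexp_mul_I_sub_taylor_le (x := s * (1 - p)) (by rw [e2]; nlinarith)
  rw [e1] at t1
  rw [e2] at t2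
  have hs2 : s ^ 2 ≤ 1 := by rw [← sq_abs]; nlinarith
  have hy0 : 0 ≤ s ^ 2 / 2 * (p - p ^ 2) := by positivity
  have hy1 : s ^ 2 / 2 * (p - p ^ 2) ≤ 1 := by nlinarith
  have t3 := Real.norm_exp_sub_one_sub_id_le (x := -(s ^ 2 / 2 * (p - p ^ 2)))
    (by rw [norm_neg, Real.norm_of_nonneg hy0]; exact hy1)
  rw [norm_neg, Real.norm_of_nonneg hy0] at t3
  have t3' : ‖Complex.exp ((-(s ^ 2 / 2 * (p - p ^ 2)) : ℝ)) - 1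
      - (-(s ^ 2 / 2 * (p - p ^ 2)) : ℝ)‖ ≤ (s ^ 2 / 2 * (p - p ^ 2)) ^ 2 := by
    rw [← Complex.ofReal_exp]
    refine le_trans (le_of_eq ?_) t3
    rw [← Complex.norm_real]; push_cast; rfl
  have t4 := norm_ofReal_mul_add_ofReal_mul_le h0 h1
    (Complex.exp ((-(s * p) : ℝ) * Complex.I) -
      (1 + (-(s * p) : ℝ) * Complex.I - (-(s * p) : ℝ) ^ 2 / 2))
    (Complex.exp ((s * (1 - p) : ℝ) * Complex.I) -
      (1 + (s * (1 - p) : ℝ) * Complex.I - (s * (1 - p) : ℝ) ^ 2 / 2))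
  have key : bernoulliCharFun p s - Complex.exp ((-(s ^ 2 / 2 * (p - p ^ 2)) : ℝ)) =
      ((1 - p) * (Complex.exp ((-(s * p) : ℝ) * Complex.I) -
        (1 + (-(s * p) : ℝ) * Complex.I - (-(s * p) : ℝ) ^ 2 / 2)) +
      p * (Complex.exp ((s * (1 - p) : ℝ) * Complex.I) -
        (1 + (s * (1 - p) : ℝ) * Complex.I - (s * (1 - p) : ℝ) ^ 2 / 2))) -
      (Complex.exp ((-(s ^ 2 / 2 * (p - p ^ 2)) : ℝ)) - 1
        - (-(s ^ 2 / 2 * (p - p ^ 2)) : ℝ)) := by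
    rw [bernoulliCharFun_eq]
    push_cast
    ring
  rw [key]
  refine (norm_sub_le _ _).trans ?_
  -- Third absolute central moment, at most the variance since p² + (1 - p)² ≤ 1.
  have b1 : (1 - p) * (|s| * p) ^ 3 + p * (|s| * (1 - p)) ^ 3 ≤ |s| ^ 3 * (p - p ^ 2) := by
    have : (1 - p) * (|s| * p) ^ 3 + p * (|s| * (1 - p)) ^ 3 =
      |s| ^ 3 * (p - p ^ 2) * (p ^ 2 + (1 - p) ^ 2) := by ring
    rw [this]
    exact mul_le_of_le_one_right (by positivity) (by nlinarith)
  have b2 : (s ^ 2 / 2 * (p - p ^ 2)) ^ 2 ≤ |s| ^ 3 * (p - p ^ 2) := by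
    have : (s ^ 2 / 2 * (p - p ^ 2)) ^ 2 =
        |s| ^ 3 * (p - p ^ 2) * (|s| * (p - p ^ 2) / 4) := by rw [← sq_abs s]; ring
    rw [this]
    exact mul_le_of_le_one_right (by positivity) (by nlinarith)
  have b3 := mul_le_mul_of_nonneg_left t1 hq
  have b4 := mul_le_mul_of_nonneg_left t2 h0
  linarith

lemma norm_prod_bernoulliCharFun_sub_exp_le {ι : Type*} (I : Finset ι) {p : ι → ℝ} {s : ℝ}
    (h0 : ∀ i ∈ I, 0 ≤ p i) (h1 : ∀ i ∈ I, p i ≤ 1) (hs : |s| ≤ 1) :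
    ‖∏ i ∈ I, bernoulliCharFun (p i) s -
      Complex.exp ((-(s ^ 2 / 2 * ∑ i ∈ I, (p i - p i ^ 2)) : ℝ))‖ ≤
      2 * |s| ^ 3 * ∑ i ∈ I, (p i - p i ^ 2) := by
  have e : Complex.exp ((-(s ^ 2 / 2 * ∑ i ∈ I, (p i - p i ^ 2)) : ℝ)) =
      ∏ i ∈ I, Complex.exp ((-(s ^ 2 / 2 * (p i - p i ^ 2)) : ℝ)) := by
    rw [← Complex.exp_sum, ← Complex.ofReal_sum, Finset.mul_sum, Finset.sum_neg_distrib]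
  rw [e, Finset.mul_sum]
  refine (norm_prod_sub_prod_le_sum I _ _
    (fun i hi => norm_bernoulliCharFun_le_one (h0 i hi) (h1 i hi) s) fun i hi => ?_).trans
    (Finset.sum_le_sum fun i hi => norm_bernoulliCharFun_sub_exp_le (h0 i hi) (h1 i hi) hs)
  rw [← Complex.ofReal_exp, Complex.norm_of_nonneg (Real.exp_nonneg _), Real.exp_le_one_iff]
  have := h0 i hi
  have := h1 i hi
  have : 0 ≤ p i - p i ^ 2 := by nlinarith
  have : 0 ≤ s ^ 2 / 2 * (p i - p i ^ 2) := by positivity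
  linarith

/-! ### Passage to the limit -/

/-- **Lyapunov's central limit theorem** for triangular arrays of centred Bernoulli variables, in
terms of characteristic functions. -/
lemma tendsto_prod_bernoulliCharFun {ι : Type*} {I : ℕ → Finset ι} {p : ι → ℝ} {v : ℕ → ℝ}
    (h0 : ∀ n, ∀ i ∈ I n, 0 ≤ p i) (h1 : ∀ n, ∀ i ∈ I n, p i ≤ 1)
    (hv : ∀ n, v n = ∑ i ∈ I n, (p i - p i ^ 2)) (hlim : Tendsto v atTop atTop) (t : ℝ) :
    Tendsto (fun n => ∏ i ∈ I n, bernoulliCharFun (p i) (t / √(v n))) atTop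
      (𝓝 (Complex.exp ((-(t ^ 2 / 2) : ℝ)))) := by
  have hsq : Tendsto (fun n => √(v n)) atTop atTop := Real.tendsto_sqrt_atTop.comp hlim
  have hs : Tendsto (fun n => |t| / √(v n)) atTop (𝓝 0) := hsq.const_div_atTop _
  rw [tendsto_iff_norm_sub_tendsto_zero]
  have hlim0 : Tendsto (fun n => 2 * |t| ^ 2 * (|t| / √(v n))) atTop (𝓝 0) := by
    simpa only [mul_zero] using hs.const_mul (2 * |t| ^ 2)
  refine squeeze_zero' (Eventually.of_forall fun _ => norm_nonneg _) ?_ hlim0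
  filter_upwards [hs.eventually_le_const one_pos, hlim.eventually_gt_atTop 0] with n hn hpos
  have hr : 0 < √(v n) := Real.sqrt_pos.2 hpos
  have hvr : √(v n) ^ 2 = v n := Real.sq_sqrt hpos.le
  have habs : |t / √(v n)| = |t| / √(v n) := by rw [abs_div, abs_of_pos hr]
  have h := norm_prod_bernoulliCharFun_sub_exp_le (I n) (h0 n) (h1 n) (habs.le.trans hn)
  rw [← hv n, habs] at h
  have e1 : (t / √(v n)) ^ 2 / 2 * v n = t ^ 2 / 2 := by
    rw [div_pow, hvr]; field_simp
  have e2 : 2 * (|t| / √(v n)) ^ 3 * v n = 2 * |t| ^ 2 * (|t| / √(v n)) := by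
    nth_rw 2 [← hvr]; field_simp
  rwa [e1, e2] at h

lemma tendsto_sum_one_div_sub_one_div_sq :
    Tendsto (fun n : ℕ => ∑ k ∈ Finset.Ico 1 n, (1 / (k : ℝ) - 1 / (k : ℝ) ^ 2)) atTop atTop := by
  have h2 : Summable fun k : ℕ => 1 / ((k : ℝ)) ^ 2 := Real.summable_one_div_nat_pow.2 one_lt_two
  have hdiv : Tendsto (fun n => ∑ k ∈ Finset.range n, 1 / (k : ℝ)) atTop atTop :=
    (not_summable_iff_tendsto_nat_atTop_of_nonneg fun k => by positivity).1
      Real.not_summable_one_div_natCast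
  refine (hdiv.atTop_add h2.hasSum.tendsto_sum_nat.neg).congr' ?_
  filter_upwards [eventually_gt_atTop 0] with n hn
  -- The extra term k = 0 vanishes since 1 / 0 = 0.
  rw [← sub_eq_add_neg, ← Finset.sum_sub_distrib, Finset.range_eq_Ico,
    Finset.sum_eq_sum_Ico_succ_bot hn]
  simp

/-- Countably many almost sure relations hold simultaneously, and on that event they determine T
from U; thereafter T can be replaced by an explicit function of U. -/
lemma ae_forall_eq_clock {Ω : Type*} [MeasurableSpace Ω] {μ : Measure Ω} {U T : ℕ → Ω → ℕ}
    (hU : ∀ n, 1 ≤ n → HasLaw (U n) (uniformOn (Set.Icc 1 n)) μ)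
    (hT_one : ∀ᵐ ω ∂μ, T 1 ω = 0)
    (hT_succ : ∀ n : ℕ, 1 ≤ n → ∀ᵐ ω ∂μ, T (n + 1) ω = 1 + T (U n ω) ω) :
    ∀ᵐ ω ∂μ, ∀ n, 1 ≤ n → T n ω = clock (fun i => U i ω) n := by
  have h1 : ∀ᵐ ω ∂μ, ∀ n, 1 ≤ n → T (n + 1) ω = 1 + T (U n ω) ω :=
    ae_all_iff.2 fun n => ae_all_iff.2 fun hn => hT_succ n hn
  have h2 : ∀ᵐ ω ∂μ, ∀ n, 1 ≤ n → 1 ≤ U n ω ∧ U n ω ≤ n :=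
    ae_all_iff.2 fun n => ae_all_iff.2 fun hn => ae_mem_Icc hU hn
  filter_upwards [hT_one, h1, h2] with ω h0 h1 h2 n
  induction n using Nat.strong_induction_on with
  | _ n ih =>
    intro hn
    obtain ⟨n, rfl⟩ := Nat.exists_eq_add_of_le' hn
    rcases Nat.eq_zero_or_pos n with rfl | hn'
    · rw [h0, clock_one]
    · rw [h1 n hn', clock_succ, if_pos (h2 n hn'),
        ih _ (by have := h2 n hn'; omega) (h2 n hn').1]

/-- Lévy's continuity theorem followed by the portmanteau theorem: the boundary {x} of the half-line
is null for the limit. -/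
lemma tendsto_measureReal_setOf_le {Ω : Type*} [MeasurableSpace Ω] {μ : Measure Ω}
    [IsProbabilityMeasure μ] {Z : ℕ → Ω → ℝ} (hZ : ∀ n, AEMeasurable (Z n) μ)
    {ν : Measure ℝ} [IsProbabilityMeasure ν] [NullSingletonClass ν]
    (h : ∀ t : ℝ, Tendsto (fun n => ∫ ω, Complex.exp (t * Z n ω * Complex.I) ∂μ) atTop
      (𝓝 (charFun ν t))) (x : ℝ) :
    Tendsto (fun n => μ.real {ω | Z n ω ≤ x}) atTop (𝓝 (cdf ν x)) := by
  let P : ℕ → ProbabilityMeasure ℝ :=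
    fun n => ⟨μ.map (Z n), Measure.isProbabilityMeasure_map (hZ n)⟩
  have hP : Tendsto P atTop (𝓝 (⟨ν, inferInstance⟩ : ProbabilityMeasure ℝ)) := by
    refine ProbabilityMeasure.tendsto_of_tendsto_charFun fun t => ?_
    refine (h t).congr fun n => ?_
    change _ = charFun (μ.map (Z n)) t
    rw [charFun_apply_real, integral_map (hZ n) (by fun_prop)]
  have h2 := ProbabilityMeasure.tendsto_measure_of_null_frontier_of_tendsto' hP
    (E := Set.Iic x) (by rw [frontier_Iic]; exact measure_singleton (μ := ν) x)
  rw [cdf_eq_real]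
  refine ((ENNReal.tendsto_toReal (measure_ne_top ν _)).comp h2).congr fun n => ?_
  change (μ.map (Z n) (Set.Iic x)).toReal = _
  rw [Measure.map_apply_of_aemeasurable (hZ n) measurableSet_Iic]
  rfl

/-- The centring factor is itself a product, as the mean is ∑ 1/k, so each factor is centred
separately. -/
lemma integral_exp_standardized_clock {Ω : Type*} [MeasurableSpace Ω] {μ : Measure Ω}
    [IsProbabilityMeasure μ] {U : ℕ → Ω → ℕ}
    (hU : ∀ n, 1 ≤ n → HasLaw (U n) (uniformOn (Set.Icc 1 n)) μ)
    (hind : iIndepFun (fun n : ℕ => U (n + 1)) μ) {n : ℕ} (hn : 1 ≤ n) (t r : ℝ) :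
    ∫ ω, Complex.exp (t * (((clock (fun i => U i ω) n : ℝ) -
        ∑ k ∈ Finset.Ico 1 n, 1 / (k : ℝ)) / r : ℝ) * Complex.I) ∂μ =
      ∏ k ∈ Finset.Ico 1 n, bernoulliCharFun (1 / (k : ℝ)) (t / r) := by
  obtain ⟨n, rfl⟩ := Nat.exists_eq_add_of_le' hn
  simp only [bernoulliCharFun]
  rw [Finset.prod_mul_distrib, ← Complex.exp_sum]
  have e : ∀ ω, Complex.exp (t * (((clock (fun i => U i ω) (n + 1) : ℝ) -
        ∑ k ∈ Finset.Ico 1 (n + 1), 1 / (k : ℝ)) / r : ℝ) * Complex.I) =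
      Complex.exp (∑ k ∈ Finset.Ico 1 (n + 1), (-(t / r * (1 / (k : ℝ))) : ℝ) * Complex.I) *
      Complex.exp ((t / r : ℝ) * Complex.I * (clock (fun i => U i ω) (n + 1) : ℂ)) := by
    intro ω
    rw [← Complex.exp_add, ← Finset.sum_mul, ← Complex.ofReal_sum, Finset.sum_neg_distrib,
      ← Finset.mul_sum]
    push_cast
    ring_nf
  simp_rw [e]
  rw [integral_const_mul, integral_exp_clock hU hind]
  congr 1
  refine Finset.prod_congr rfl fun k _ => ?_
  push_cast
  ring

/-- Central limit theorem for the uniformly reverting clock. The sequence `U 1, U 2, …` is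
independent, with `U n` uniform on `{1, …, n}`, and `T 1 = 0`, `T (n + 1) = 1 + T (U n)` for
`n ≥ 1`. (The values `U 0` and `T 0` play no role.) -/
theorem theorem1 {Ω : Type*} [MeasurableSpace Ω] (μ : Measure Ω) [IsProbabilityMeasure μ]
    (U : ℕ → Ω → ℕ)
    (hU_law : ∀ n : ℕ, 1 ≤ n → HasLaw (U n) (uniformOn (Set.Icc 1 n)) μ)
    (hU_indep : iIndepFun (fun n : ℕ => U (n + 1)) μ)
    (T : ℕ → Ω → ℕ)
    (hT_one : ∀ᵐ ω ∂μ, T 1 ω = 0)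
    (hT_succ : ∀ n : ℕ, 1 ≤ n → ∀ᵐ ω ∂μ, T (n + 1) ω = 1 + T (U n ω) ω)
    (m v : ℕ → ℝ)
    (hm : ∀ n : ℕ, m n = ∫ ω, (T n ω : ℝ) ∂μ)
    (hv : ∀ n : ℕ, v n = variance (fun ω => (T n ω : ℝ)) μ) :
    (∀ n : ℕ, 1 ≤ n →
      MemLp (fun ω => (T n ω : ℝ)) 2 μ ∧
      m n = ∑ k ∈ Finset.Ico 1 n, 1 / (k : ℝ) ∧
      v n = ∑ k ∈ Finset.Ico 1 n, (1 / (k : ℝ) - 1 / (k : ℝ) ^ 2)) ∧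
    ∀ x : ℝ,
      Tendsto (fun n : ℕ => μ.real {ω | ((T n ω : ℝ) - m n) / √(v n) ≤ x}) atTop
        (𝓝 (cdf (gaussianReal 0 1) x)) := by
  have hmeas : ∀ n, 1 ≤ n → AEMeasurable (U n) μ := fun n hn => (hU_law n hn).aemeasurable
  have hT : ∀ n, 1 ≤ n → ∀ᵐ ω ∂μ, T n ω = clock (fun i => U i ω) n := fun n hn => by
    filter_upwards [ae_forall_eq_clock hU_law hT_one hT_succ] with ω h using h n hn
  have hTR : ∀ n, 1 ≤ n → (fun ω => (T n ω : ℝ)) =ᵐ[μ] fun ω => (clock (fun i => U i ω) n : ℝ) :=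
    fun n hn => by filter_upwards [hT n hn] with ω h using by rw [h]
  have hL2 : ∀ n, MemLp (fun ω => (clock (fun i => U i ω) n : ℝ)) 2 μ := fun n =>
    (memLp_two_iff_integrable_sq
      (integrable_comp_clock hmeas (fun j => (j : ℝ)) n).aestronglyMeasurable).2
      (integrable_comp_clock hmeas (fun j => (j : ℝ) ^ 2) n)
  have hmean : ∀ n, 1 ≤ n → m n = ∑ k ∈ Finset.Ico 1 n, 1 / (k : ℝ) := fun n hn => by
    rw [hm, integral_congr_ae (hTR n hn)]
    obtain ⟨n, rfl⟩ := Nat.exists_eq_add_of_le' hn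
    exact integral_clock hU_law hU_indep n
  have hvar : ∀ n, 1 ≤ n → v n = ∑ k ∈ Finset.Ico 1 n, (1 / (k : ℝ) - 1 / (k : ℝ) ^ 2) :=
      fun n hn => by
    rw [hv, variance_congr (hTR n hn), variance_eq_sub (hL2 n)]
    obtain ⟨n, rfl⟩ := Nat.exists_eq_add_of_le' hn
    simp only [Pi.pow_apply]
    rw [integral_clock_sq hU_law hU_indep, integral_clock hU_law hU_indep]
    ring
  refine ⟨fun n hn => ⟨(hL2 n).ae_eq (hTR n hn).symm, hmean n hn, hvar n hn⟩, fun x => ?_⟩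
  have : NullSingletonClass (gaussianReal 0 1) := nullSingletonClass_gaussianReal one_ne_zero
  set w : ℕ → ℝ := fun n => ∑ k ∈ Finset.Ico 1 n, (1 / (k : ℝ) - 1 / (k : ℝ) ^ 2) with hw
  -- Stated for the clock, which is measurable at every n; T is only controlled for n ≥ 1, which
  -- suffices for the limit.
  refine (tendsto_measureReal_setOf_le (μ := μ) (ν := gaussianReal 0 1)
    (Z := fun n ω => ((clock (fun i => U i ω) n : ℝ) - ∑ k ∈ Finset.Ico 1 n, 1 / (k : ℝ)) / √(w n))
    (fun n => ?_) (fun t => ?_) x).congr' ?_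
  · exact ((hL2 n).aestronglyMeasurable.aemeasurable.sub_const _).div_const _
  · have hlim := tendsto_prod_bernoulliCharFun (I := fun n => Finset.Ico 1 n)
      (p := fun k : ℕ => 1 / (k : ℝ)) (v := w) (fun _ _ _ => by positivity)
      (fun n k hk => by
        have : (1 : ℝ) ≤ k := by exact_mod_cast (Finset.mem_Ico.1 hk).1
        exact (div_le_one (by linarith)).2 this)
      (fun n => by simp only [hw, one_div, inv_pow]) tendsto_sum_one_div_sub_one_div_sq t
    have hg : charFun (gaussianReal 0 1) t = Complex.exp ((-(t ^ 2 / 2) : ℝ)) := by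
      rw [charFun_gaussianReal]; push_cast; simp
    rw [hg]
    refine hlim.congr' ?_
    filter_upwards [eventually_ge_atTop 1] with n hn
    exact (integral_exp_standardized_clock hU_law hU_indep hn t _).symm
  · filter_upwards [eventually_ge_atTop 1] with n hn
    refine measureReal_congr ?_
    filter_upwards [hT n hn] with ω h
    change (_ ≤ x) = (_ ≤ x)
    rw [h, hmean n hn, hvar n hn]
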